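/- Let $k$ be a field. A standard graded $k$-algebra is a graded $k$-algebra $R=\bigoplus_{n\ge 0}R_n$ generated over $k$ by finitely many forms of degree one; let $\mathfrak m$ be its maximal graded ideal. For a finitely generated graded $R$-module $M$ let $\operatorname{reg} M=\max\{a(H^i_{\mathfrak m}(M))+i \mid i\ge 0\}$ be its Castelnuovo–Mumford regularity, where $a(H)$ is the largest degree in which the graded module $H$ does not vanish ($a(0)=-\infty$). All ideals $I\subset R$ below are graded, proper, and satisfy $I^n\ne 0$ for all $n\ge 1$. If $I$ is generated by forms of degree $d$, the sequence $e_n=\operatorname{reg} I^n-dn$, $n\ge 1$, is called the defect sequence of the function $\operatorname{reg} I^n$. Theorem. Let $k$ be a field and let $d\ge 1$. (1) Let $\{e_n\}_{n\ge 1}$ be a weakly decreasing sequence of non-negative integers, let $m\ge 1$ be the least integer such that $e_n=e_m$ for all $n>m$, and assume that $e_n-e_{n+1}\ge d$ for all $1\le n<m$. Then there are a standard graded $k$-algebra $R$ and an ideal $I$ of $R$ generated by forms of degree $d$ with $\dim R/I=0$ such that $\{e_n\}$ is the defect sequence of the function $\operatorname{reg} I^n$. (2) Let $s\ge 0$ be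 an integer and let $f(n)$, $n\ge 1$, be an integer-valued function with $f(n)\ge dn$ for all $n\ge 1$ for which there is an $m\ge 1$ such that $f(n)\ge f(n+1)$ for $1\le n<m$ and $f(n+1)=f(n)+d$ for $n\ge m$. Then there are a standard graded $k$-algebra $R$ and an ideal $I$ of $R$ generated by forms of degree $d$ with $\dim R/I=s$ such that $\operatorname{reg} I^n=f(n)$ for all $n\ge 1$. (3) There are a standard graded $k$-algebra $R$ and an ideal $I$ of $R$ generated by forms of degree $d$ with $\dim R/I=0$ such that the sequence $\{e_n\}_{n\ge 1}$, $e_n=\operatorname{reg} I^n-dn$, consists of non-negative integers and $\{e_n-e_{n+1}\}_{n\ge 1}$ is not weakly decreasing. (This answers a question of Eisenbud and Ulrich negatively.) -/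

import Mathlib

universe u v

namespace CMRegularity

section Cech

/-- The multiplicative subset of `R` generated by the elements `x i`, `i ∈ F`. -/
def denoms {R : Type u} [CommRing R] {r : ℕ} (x : Fin r → R) (F : Finset (Fin r)) :
    Submonoid R :=
  Submonoid.closure (x '' (F : Set (Fin r)))

theorem denoms_mono {R : Type u} [CommRing R] {r : ℕ} (x : Fin r → R)
    {F G : Finset (Fin r)} (h : F ⊆ G) : denoms x F ≤ denoms x G :=
  Submonoid.closure_mono (Set.image_mono (by exact_mod_cast h))

/-- All cochains of the (extended, alternating) Čech complex of `M` with respect to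
`x_1, …, x_r`: families indexed by the subsets `F` of `{1, …, r}`, with component at `F` in
the localization `M_{x_F}`, where `x_F = ∏_{i ∈ F} x_i`.  The term of the complex in
cohomological degree `p` consists of the families that live on the sets with `p` elements. -/
abbrev Cochain {R : Type u} [CommRing R] {r : ℕ} (x : Fin r → R)
    (M : Type v) [AddCommGroup M] [Module R M] : Type (max u v) :=
  (F : Finset (Fin r)) → LocalizedModule (denoms x F) M

/-- The Čech differential: `(dc)(G) = ∑_{i ∈ G} (-1)^{#{j ∈ G, j < i}} c(G \ {i})`, where
`c(G \ {i})` is sent to `M_{x_G}` by the natural map. -/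
noncomputable def cechDiff {R : Type u} [CommRing R] {r : ℕ} (x : Fin r → R)
    (M : Type v) [AddCommGroup M] [Module R M] : Cochain x M →ₗ[R] Cochain x M :=
  LinearMap.pi fun G => ∑ i ∈ G, ((-1 : R) ^ (G.filter (· < i)).card) •
    (LocalizedModule.liftOfLE (denoms x (G.erase i)) (denoms x G)
      (denoms_mono x (G.erase_subset i))).comp (LinearMap.proj (G.erase i))

/-- The homogeneous component of degree `j` of the graded module `M_{x_F}`: it is generated by
the fractions `m / s` with `s` of degree `t` and `m` of degree `j + t`. -/
def localizedDegree {k R : Type u} [Field k] [CommRing R] [Algebra k R]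
    (𝒜 : ℕ → Submodule k R) {r : ℕ} (x : Fin r → R)
    {M : Type v} [AddCommGroup M] [Module R M] (ℳ : ℤ → AddSubgroup M)
    (F : Finset (Fin r)) (j : ℤ) : AddSubgroup (LocalizedModule (denoms x F) M) :=
  AddSubgroup.closure {z | ∃ (t : ℕ) (s : denoms x F) (m : M),
    (s : R) ∈ 𝒜 t ∧ m ∈ ℳ (j + t) ∧ z = LocalizedModule.mk m s}

/-- The Čech cochains of cohomological degree `p` that are homogeneous of degree `j`. -/
def cochains {k R : Type u} [Field k] [CommRing R] [Algebra k R]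
    (𝒜 : ℕ → Submodule k R) {r : ℕ} (x : Fin r → R)
    {M : Type v} [AddCommGroup M] [Module R M] (ℳ : ℤ → AddSubgroup M)
    (p : ℕ) (j : ℤ) : AddSubgroup (Cochain x M) where
  carrier := {c | (∀ F, F.card ≠ p → c F = 0) ∧ ∀ F, c F ∈ localizedDegree 𝒜 x ℳ F j}
  zero_mem' := ⟨fun _ _ => rfl, fun _ => zero_mem _⟩
  add_mem' := fun {a b} ha hb =>
    ⟨fun F hF => by simp [ha.1 F hF, hb.1 F hF], fun F => add_mem (ha.2 F) (hb.2 F)⟩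
  neg_mem' := fun {a} ha =>
    ⟨fun F hF => by simp [ha.1 F hF], fun F => neg_mem (ha.2 F)⟩

/-- The cocycles of cohomological degree `p` and internal degree `j`. -/
noncomputable def cocycles {k R : Type u} [Field k] [CommRing R] [Algebra k R]
    (𝒜 : ℕ → Submodule k R) {r : ℕ} (x : Fin r → R)
    {M : Type v} [AddCommGroup M] [Module R M] (ℳ : ℤ → AddSubgroup M)
    (p : ℕ) (j : ℤ) : AddSubgroup (Cochain x M) :=
  cochains 𝒜 x ℳ p j ⊓ (cechDiff x M).toAddMonoidHom.ker

/-- The coboundaries of cohomological degree `p` and internal degree `j`. -/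
noncomputable def coboundaries {k R : Type u} [Field k] [CommRing R] [Algebra k R]
    (𝒜 : ℕ → Submodule k R) {r : ℕ} (x : Fin r → R)
    {M : Type v} [AddCommGroup M] [Module R M] (ℳ : ℤ → AddSubgroup M) :
    ℕ → ℤ → AddSubgroup (Cochain x M)
  | 0, _ => ⊥
  | p + 1, j => (cochains 𝒜 x ℳ p j).map (cechDiff x M).toAddMonoidHom

/-- The degree `j` component `H^p_𝔪(M)_j` of the `p`-th local cohomology module of the graded
module `M` with respect to the ideal `𝔪 = (x_1, …, x_r)`, as the cohomology of the degree `j`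
strand of the Čech complex. -/
abbrev LocalCohomology {k R : Type u} [Field k] [CommRing R] [Algebra k R]
    (𝒜 : ℕ → Submodule k R) {r : ℕ} (x : Fin r → R)
    {M : Type v} [AddCommGroup M] [Module R M] (ℳ : ℤ → AddSubgroup M)
    (p : ℕ) (j : ℤ) : Type (max u v) :=
  cocycles 𝒜 x ℳ p j ⧸ (coboundaries 𝒜 x ℳ p j).addSubgroupOf (cocycles 𝒜 x ℳ p j)

/-- `a(H^p_𝔪(M))`: the largest degree in which `H^p_𝔪(M)` does not vanish (`⊥ = -∞` if
`H^p_𝔪(M) = 0`, and `⊤ = +∞` if there are arbitrarily large such degrees). -/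
noncomputable def aInvariant {k R : Type u} [Field k] [CommRing R] [Algebra k R]
    (𝒜 : ℕ → Submodule k R) {r : ℕ} (x : Fin r → R)
    {M : Type v} [AddCommGroup M] [Module R M] (ℳ : ℤ → AddSubgroup M)
    (p : ℕ) : WithBot (WithTop ℤ) :=
  sSup ((fun j : ℤ => ((j : WithTop ℤ) : WithBot (WithTop ℤ))) ''
    {j : ℤ | Nontrivial (LocalCohomology 𝒜 x ℳ p j)})

/-- The Castelnuovo–Mumford regularity `reg M = max {a(H^p_𝔪(M)) + p | p ≥ 0}` of the graded
module `M = ⨁_j ℳ j` over the standard graded algebra `R = ⨁_n 𝒜 n`, whose maximal graded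
ideal `𝔪` is generated by the forms `x_1, …, x_r` of degree one. -/
noncomputable def reg {k R : Type u} [Field k] [CommRing R] [Algebra k R]
    (𝒜 : ℕ → Submodule k R) {r : ℕ} (x : Fin r → R)
    {M : Type v} [AddCommGroup M] [Module R M] (ℳ : ℤ → AddSubgroup M) :
    WithBot (WithTop ℤ) :=
  ⨆ p : ℕ, aInvariant 𝒜 x ℳ p + (((p : ℤ) : WithTop ℤ) : WithBot (WithTop ℤ))

end Cech

/-- The `ℕ`-graded algebra `R = ⨁_n 𝒜 n` is a standard graded `k`-algebra, generated by the
finitely many forms `x_1, …, x_r` of degree one. -/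
structure IsStandardGraded {k R : Type u} [Field k] [CommRing R] [Algebra k R]
    (𝒜 : ℕ → Submodule k R) [GradedAlgebra 𝒜] {r : ℕ} (x : Fin r → R) : Prop where
  mem_one : ∀ i, x i ∈ 𝒜 1
  adjoin_eq_top : Algebra.adjoin k (Set.range x) = ⊤

/-- The grading that a homogeneous ideal `J` of `R = ⨁_n 𝒜 n` inherits from `R`, indexed by
`ℤ`: `J_j = J ∩ R_j`, which is zero for `j < 0`. -/
def idealDegree {k R : Type u} [Field k] [CommRing R] [Algebra k R]
    (𝒜 : ℕ → Submodule k R) (J : Ideal R) (j : ℤ) : AddSubgroup J where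
  carrier := {f | f = 0 ∨ 0 ≤ j ∧ (f : R) ∈ 𝒜 j.toNat}
  zero_mem' := Or.inl rfl
  add_mem' := by
    rintro a b (rfl | ha) (rfl | hb)
    · simp
    · simpa using Or.inr hb
    · simpa using Or.inr ha
    · exact Or.inr ⟨ha.1, by simpa using add_mem ha.2 hb.2⟩
  neg_mem' := by
    rintro a (rfl | ha)
    · simp
    · exact Or.inr ⟨ha.1, by simpa using ha.2⟩

/-- `I` is generated by forms of degree `d`. -/
def IsGeneratedInDegree {k R : Type u} [Field k] [CommRing R] [Algebra k R]
    (𝒜 : ℕ → Submodule k R) (d : ℕ) (I : Ideal R) : Prop :=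
  ∃ s : Set R, s ⊆ (𝒜 d : Set R) ∧ I = Ideal.span s

/-- The function `f(n)`, `n ≥ 1`, is the function `reg I^n` of some proper, non-nilpotent ideal
`I` generated by forms of degree `d` in some standard graded `k`-algebra `R` with
`dim R/I = s`. -/
def IsRegFunction (k : Type u) [Field k] (d s : ℕ) (f : ℕ → ℤ) : Prop :=
  ∃ (R : Type u) (_ : CommRing R) (_ : Algebra k R) (𝒜 : ℕ → Submodule k R)
    (_ : GradedAlgebra 𝒜) (r : ℕ) (x : Fin r → R) (I : Ideal R),
    IsStandardGraded 𝒜 x ∧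
    IsGeneratedInDegree 𝒜 d I ∧
    I ≠ ⊤ ∧
    (∀ n : ℕ, 1 ≤ n → I ^ n ≠ ⊥) ∧
    ringKrullDim (R ⧸ I) = s ∧
    ∀ n : ℕ, 1 ≤ n →
      reg 𝒜 x (idealDegree 𝒜 (I ^ n)) = ((f n : WithTop ℤ) : WithBot (WithTop ℤ))

/-- The sequence `e_n`, `n ≥ 1`, is the defect sequence `e_n = reg I^n - dn` of the function
`reg I^n` of some proper, non-nilpotent ideal `I` generated by forms of degree `d` in some
standard graded `k`-algebra `R` with `dim R/I = s`. -/
def IsDefectSequence (k : Type u) [Field k] (d s : ℕ) (e : ℕ → ℕ) : Prop :=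
  IsRegFunction k d s fun n => (d : ℤ) * n + e n

end CMRegularity

/-! Everything reduces to part (2). It is realized by a principal ideal `I = (x ^ d)` in a quotient
of `k[x, w, z_1, …, z_s]` by monomials. Since all `x z_i` and high powers of `w` times `x` vanish,
only `x` acts non-nilpotently on `I ^ n = (x ^ (d * n))`. Its Čech complex is then `M → M_x`: the
module `H^0` is the `x`-torsion, `H^1` is the cokernel, and the rest vanishes.

As a `k[x]`-module, `I ^ n` splits into rows, one for each power `w ^ b`. Put `c = f m - d * m`. The
rows with `b ≤ c` are infinite. Each is free with generator `x ^ (d * n) * w ^ b`, so its `H^1` ends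
in degree `d * n + b - 1`, and together they contribute `d * n + c` to the regularity. This is `f n`
for `n ≥ m` and at most `f n` for `n < m`.

The rows with `b > c` are finite and are torsion. They form a staircase with corners `x ^ (d * (n' +
1) - 1) * w ^ (f n' + 1 - d * (n' + 1))`, `1 ≤ n' < m`, each corner having degree exactly `f n'`. A
row that meets `I ^ n` lies under a corner with `n' ≥ n`, so its degrees are at most `f n' ≤ f n`.
For `n < m` the corner `n' = n` lies in `I ^ n` and attains the bound; for `n ≥ m` no torsion is
left.

The monomials in the `z_i` alone survive, and `x`, `w` are nilpotent modulo `I`, whence `dim R/I =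
s`. The algebraic core is `reg_eq_of_forall_subsingleton`, `le_of_mem_torsion` and
`exists_torsion_eq_zero`, assembled in `isRegFunction_of_antitone_of_linear`. -/

namespace CMRegularity

/-! ### Local cohomology when a single generator acts non-nilpotently -/

section OneVariable

variable {k R : Type u} [Field k] [CommRing R] [Algebra k R] {𝒜 : ℕ → Submodule k R} {r : ℕ}
  {x : Fin r → R} {M : Type v} [AddCommGroup M] [Module R M] {ℳ : ℤ → AddSubgroup M}

theorem mem_denoms_empty {a : R} : a ∈ denoms x ∅ ↔ a = 1 := by
  simp [denoms]

theorem mem_denoms_singleton {i : Fin r} {a : R} : a ∈ denoms x {i} ↔ ∃ n : ℕ, x i ^ n = a := by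
  simp [denoms, Submonoid.mem_closure_singleton]

/-- `M_{x_F} = 0` if some `x_i`, `i ∈ F`, acts nilpotently on `M`. -/
theorem subsingleton_localizedModule {F : Finset (Fin r)} {i : Fin r} (hi : i ∈ F) {N : ℕ}
    (hN : ∀ m : M, x i ^ N • m = 0) : Subsingleton (LocalizedModule (denoms x F) M) := by
  rw [LocalizedModule.subsingleton_iff]
  have hx : x i ∈ denoms x F := Submonoid.subset_closure ⟨i, hi, rfl⟩
  exact fun m => ⟨x i ^ N, pow_mem hx N, hN m⟩

/-- The only denominator is `1`. The hypothesis `hone` prevents it from also counting as a form of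
positive degree, which would mix the degrees of the fractions. -/
theorem mem_localizedDegree_empty {j : ℤ} (h1 : (1 : R) ∈ 𝒜 0)
    (hone : ∀ t, (1 : R) ∈ 𝒜 t → t = 0) {z : LocalizedModule (denoms x ∅) M} :
    z ∈ localizedDegree 𝒜 x ℳ ∅ j ↔ ∃ m ∈ ℳ j, z = LocalizedModule.mk m 1 := by
  have hs (s : denoms x ∅) : s = 1 := Subtype.ext (mem_denoms_empty.1 s.2)
  constructor
  · intro hz
    suffices h : localizedDegree 𝒜 x ℳ ∅ j ≤ (ℳ j).map
        (LocalizedModule.mkLinearMap (denoms x ∅) M).toAddMonoidHom by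
      obtain ⟨m, hm, rfl⟩ := h hz
      exact ⟨m, hm, rfl⟩
    refine (AddSubgroup.closure_le _).2 ?_
    rintro _ ⟨t, s, m, hst, hm, rfl⟩
    obtain rfl := hs s
    obtain rfl := hone t hst
    exact ⟨m, by simpa using hm, rfl⟩
  · rintro ⟨m, hm, rfl⟩
    exact AddSubgroup.subset_closure ⟨0, 1, m, h1, by simpa using hm, rfl⟩

theorem cechDiff_apply_singleton {i : Fin r} {c : Cochain x M} {m : M}
    (hc : c ∅ = LocalizedModule.mk m 1) : cechDiff x M c {i} = LocalizedModule.mk m 1 := by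
  have key : ∀ F : Finset (Fin r), F = ∅ → ∀ h : denoms x F ≤ denoms x {i},
      LocalizedModule.liftOfLE (denoms x F) (denoms x {i}) h (c F) = LocalizedModule.mk m 1 := by
    rintro _ rfl h
    rw [hc]
    exact IsLocalizedModule.liftOfLE_apply _ _ h _ _ m
  simp only [cechDiff, LinearMap.pi_apply, Finset.sum_singleton]
  have h0 : (Finset.filter (· < i) {i}).card = 0 := by simp [Finset.filter_singleton]
  rw [h0, pow_zero, one_smul]
  exact key _ (Finset.erase_singleton i) (denoms_mono x (Finset.erase_subset i {i}))

theorem cechDiff_apply_empty (c : Cochain x M) : cechDiff x M c ∅ = 0 := by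
  simp [cechDiff]

theorem nontrivial_localCohomology_iff {p : ℕ} {j : ℤ} :
    Nontrivial (LocalCohomology 𝒜 x ℳ p j) ↔
      ∃ c ∈ cocycles 𝒜 x ℳ p j, c ∉ coboundaries 𝒜 x ℳ p j := by
  rw [← not_subsingleton_iff_nontrivial, LocalCohomology, QuotientAddGroup.subsingleton_iff,
    AddSubgroup.addSubgroupOf_eq_top, SetLike.not_le_iff_exists]

/-- Hence the Čech complex collapses to `M → M_{x_{i₀}}`, and cochains need to be compared only at
`∅` and `{i₀}`. -/
theorem eq_singleton_or_subsingleton {i₀ : Fin r}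
    (hv : ∀ F : Finset (Fin r), ∀ i ∈ F, i ≠ i₀ → Subsingleton (LocalizedModule (denoms x F) M))
    (F : Finset (Fin r)) :
    F = ∅ ∨ F = {i₀} ∨ Subsingleton (LocalizedModule (denoms x F) M) := by
  by_cases h : ∃ i ∈ F, i ≠ i₀
  · obtain ⟨i, hi, hne⟩ := h
    exact Or.inr (Or.inr (hv F i hi hne))
  · push Not at h
    rcases Finset.subset_singleton_iff.1 (fun i hi => Finset.mem_singleton.2 (h i hi)) with h | h
    · exact Or.inl h
    · exact Or.inr (Or.inl h)

/-- If `x_i` acts nilpotently on `M` for `i ≠ i₀`, then `H^p_𝔪(M) = 0` for `p ≥ 2`. -/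
theorem not_nontrivial_localCohomology {i₀ : Fin r}
    (hv : ∀ F : Finset (Fin r), ∀ i ∈ F, i ≠ i₀ → Subsingleton (LocalizedModule (denoms x F) M))
    {p : ℕ} (hp : 2 ≤ p) (j : ℤ) : ¬ Nontrivial (LocalCohomology 𝒜 x ℳ p j) := by
  rw [nontrivial_localCohomology_iff]
  rintro ⟨c, hc, hc'⟩
  refine hc' ?_
  have : c = 0 := by
    funext F
    rcases eq_singleton_or_subsingleton hv F with rfl | rfl | h
    · exact hc.1.1 _ (by simp; omega)
    · exact hc.1.1 _ (by simp; omega)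
    · exact Subsingleton.elim _ _
  exact this ▸ zero_mem _

theorem mk_one_eq_zero_iff {i : Fin r} {m : M} :
    (LocalizedModule.mk m 1 : LocalizedModule (denoms x {i}) M) = 0 ↔
      ∃ N : ℕ, x i ^ N • m = 0 := by
  rw [← LocalizedModule.zero_mk 1, LocalizedModule.mk_eq]
  constructor
  · rintro ⟨⟨u, hu⟩, h⟩
    obtain ⟨N, rfl⟩ := mem_denoms_singleton.1 hu
    exact ⟨N, by simpa [Submonoid.smul_def] using h⟩
  · rintro ⟨N, h⟩
    exact ⟨⟨x i ^ N, mem_denoms_singleton.2 ⟨N, rfl⟩⟩, by simpa [Submonoid.smul_def] using h⟩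

theorem mk_one_eq_mk_iff {i : Fin r} {m m' : M} {t : ℕ} {h : x i ^ t ∈ denoms x {i}} :
    (LocalizedModule.mk m' 1 : LocalizedModule (denoms x {i}) M) =
      LocalizedModule.mk m ⟨x i ^ t, h⟩ ↔ ∃ N : ℕ, x i ^ N • (x i ^ t • m' - m) = 0 := by
  rw [LocalizedModule.mk_eq]
  constructor
  · rintro ⟨⟨u, hu⟩, h⟩
    obtain ⟨N, rfl⟩ := mem_denoms_singleton.1 hu
    exact ⟨N, by simpa [Submonoid.smul_def, smul_sub, sub_eq_zero] using h⟩
  · rintro ⟨N, h⟩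
    exact ⟨⟨x i ^ N, mem_denoms_singleton.2 ⟨N, rfl⟩⟩,
      by simpa [Submonoid.smul_def, smul_sub, sub_eq_zero] using h⟩

/-- If `x_i` acts nilpotently on `M` for `i ≠ i₀`, then `H^0_𝔪(M)` is the `x_{i₀}`-torsion. -/
theorem nontrivial_localCohomology_zero_iff {i₀ : Fin r} (h1 : (1 : R) ∈ 𝒜 0)
    (hone : ∀ t, (1 : R) ∈ 𝒜 t → t = 0)
    (hv : ∀ F : Finset (Fin r), ∀ i ∈ F, i ≠ i₀ → Subsingleton (LocalizedModule (denoms x F) M))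
    {j : ℤ} : Nontrivial (LocalCohomology 𝒜 x ℳ 0 j) ↔
      ∃ m ∈ ℳ j, m ≠ 0 ∧ ∃ N : ℕ, x i₀ ^ N • m = 0 := by
  rw [nontrivial_localCohomology_iff]
  constructor
  · rintro ⟨c, ⟨⟨hc0, hcj⟩, hd⟩, hc⟩
    obtain ⟨m, hm, hcm⟩ := (mem_localizedDegree_empty h1 hone).1 (hcj ∅)
    refine ⟨m, hm, ?_, mk_one_eq_zero_iff.1 ?_⟩
    · rintro rfl
      refine hc ?_
      change c = 0
      funext F
      by_cases hF : F.card = 0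
      · obtain rfl := Finset.card_eq_zero.1 hF
        rw [hcm, LocalizedModule.zero_mk]
        rfl
      · exact hc0 F hF
    · rw [← cechDiff_apply_singleton hcm]
      exact congrFun (show cechDiff x M c = 0 from hd) {i₀}
  · rintro ⟨m, hm, hm0, hN⟩
    refine ⟨Pi.single ∅ (LocalizedModule.mk m 1), ⟨⟨fun F hF => ?_, fun F => ?_⟩, ?_⟩, ?_⟩
    · exact Pi.single_eq_of_ne (by rintro rfl; simp at hF) _
    · by_cases hF : F = ∅
      · subst hF
        rw [Pi.single_eq_same]
        exact (mem_localizedDegree_empty h1 hone).2 ⟨m, hm, rfl⟩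
      · rw [Pi.single_eq_of_ne hF]
        exact zero_mem _
    · change cechDiff x M _ = 0
      funext F
      rcases eq_singleton_or_subsingleton hv F with rfl | rfl | h
      · exact cechDiff_apply_empty _
      · rw [cechDiff_apply_singleton (m := m) (Pi.single_eq_same _ _)]
        exact mk_one_eq_zero_iff.2 hN
      · exact Subsingleton.elim _ _
    · intro h
      have h' : (Pi.single ∅ (LocalizedModule.mk m 1) : Cochain x M) = 0 := h
      have h2 := congrFun h' ∅
      rw [Pi.single_eq_same, Pi.zero_apply, ← LocalizedModule.zero_mk 1,
        LocalizedModule.mk_eq] at h2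
      obtain ⟨⟨u, hu⟩, h2⟩ := h2
      obtain rfl := mem_denoms_empty.1 hu
      exact hm0 (by simpa [Submonoid.smul_def] using h2)

/-- If `x_i` acts nilpotently on `M` for `i ≠ i₀`, then `H^1_𝔪(M)` is the cokernel of
`M → M_{x_{i₀}}`. -/
theorem nontrivial_localCohomology_one_iff {i₀ : Fin r}
    (hx : ∀ a t, x i₀ ^ a ∈ 𝒜 t ↔ a = t)
    (hv : ∀ F : Finset (Fin r), ∀ i ∈ F, i ≠ i₀ → Subsingleton (LocalizedModule (denoms x F) M))
    {j : ℤ} : Nontrivial (LocalCohomology 𝒜 x ℳ 1 j) ↔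
      ∃ t : ℕ, ∃ m ∈ ℳ (j + t), ∀ m' ∈ ℳ j, ∀ N : ℕ, x i₀ ^ N • (x i₀ ^ t • m' - m) ≠ 0 := by
  have h1 : (1 : R) ∈ 𝒜 0 := by simpa using hx 0 0
  have hone : ∀ t, (1 : R) ∈ 𝒜 t → t = 0 := fun t ht => ((hx 0 t).1 (by simpa using ht)).symm
  rw [nontrivial_localCohomology_iff]
  constructor
  · rintro ⟨c, ⟨⟨hc0, hcj⟩, hd⟩, hc⟩
    by_contra! hcon
    -- If every fraction `m / x ^ t` of degree `j` came from `M`, the cocycle would be the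
    -- coboundary of an element of `M`.
    have hle : localizedDegree 𝒜 x ℳ {i₀} j ≤ (ℳ j).map
        (LocalizedModule.mkLinearMap (denoms x {i₀}) M).toAddMonoidHom := by
      refine (AddSubgroup.closure_le _).2 ?_
      rintro _ ⟨t, ⟨s, hs⟩, m, hst, hm, rfl⟩
      obtain ⟨a, rfl⟩ := mem_denoms_singleton.1 hs
      obtain rfl := (hx _ _).1 hst
      obtain ⟨m', hm', hN⟩ := hcon a m hm
      exact ⟨m', hm', mk_one_eq_mk_iff.2 hN⟩
    obtain ⟨m, hm, hcm⟩ := hle (hcj {i₀})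
    replace hcm : LocalizedModule.mk m 1 = c {i₀} := hcm
    refine hc ⟨Pi.single ∅ (LocalizedModule.mk m 1), ⟨fun F hF => ?_, fun F => ?_⟩, ?_⟩
    · exact Pi.single_eq_of_ne (by rintro rfl; simp at hF) _
    · by_cases hF : F = ∅
      · subst hF
        rw [Pi.single_eq_same]
        exact (mem_localizedDegree_empty h1 hone).2 ⟨m, hm, rfl⟩
      · rw [Pi.single_eq_of_ne hF]
        exact zero_mem _
    · change cechDiff x M _ = c
      funext F
      rcases eq_singleton_or_subsingleton hv F with rfl | rfl | h
      · rw [cechDiff_apply_empty, hc0 ∅ (by simp)]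
      · rw [cechDiff_apply_singleton (m := m) (Pi.single_eq_same _ _), hcm]
      · exact Subsingleton.elim _ _
  · rintro ⟨t, m, hm, hm'⟩
    have hst : x i₀ ^ t ∈ denoms x {i₀} := mem_denoms_singleton.2 ⟨t, rfl⟩
    refine ⟨Pi.single {i₀} (LocalizedModule.mk m ⟨x i₀ ^ t, hst⟩),
      ⟨⟨fun F hF => ?_, fun F => ?_⟩, ?_⟩, ?_⟩
    · exact Pi.single_eq_of_ne (by rintro rfl; simp at hF) _
    · by_cases hF : F = {i₀}
      · subst hF
        rw [Pi.single_eq_same]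
        exact AddSubgroup.subset_closure ⟨t, _, m, (hx t t).2 rfl, hm, rfl⟩
      · rw [Pi.single_eq_of_ne hF]
        exact zero_mem _
    · change cechDiff x M _ = 0
      funext F
      rcases eq_singleton_or_subsingleton hv F with rfl | rfl | h
      · exact cechDiff_apply_empty _
      · rw [cechDiff_apply_singleton (m := 0), LocalizedModule.zero_mk]
        · rfl
        · rw [Pi.single_eq_of_ne (Finset.singleton_ne_empty i₀).symm, LocalizedModule.zero_mk]
      · exact Subsingleton.elim _ _
    · rintro ⟨b, ⟨hb0, hbj⟩, hb⟩
      obtain ⟨m', hmj, hbm⟩ := (mem_localizedDegree_empty h1 hone).1 (hbj ∅)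
      have h2 := congrFun (show cechDiff x M b = _ from hb) {i₀}
      rw [cechDiff_apply_singleton hbm, Pi.single_eq_same] at h2
      obtain ⟨N, hN⟩ := mk_one_eq_mk_iff.1 h2
      exact hm' m' hmj N hN

/-- The regularity of a module on which all but one of the generators of `𝔪` act nilpotently. -/
theorem reg_eq_of_forall_subsingleton {i₀ : Fin r} (hx : ∀ a t, x i₀ ^ a ∈ 𝒜 t ↔ a = t)
    (hv : ∀ F : Finset (Fin r), ∀ i ∈ F, i ≠ i₀ → Subsingleton (LocalizedModule (denoms x F) M))
    {a : ℤ} (htors : ∀ j, ∀ m ∈ ℳ j, m ≠ 0 → (∃ N : ℕ, x i₀ ^ N • m = 0) → j ≤ a)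
    (hcoker : ∀ j, a ≤ j → ∀ t : ℕ, ∀ m ∈ ℳ (j + t),
      ∃ m' ∈ ℳ j, ∃ N : ℕ, x i₀ ^ N • (x i₀ ^ t • m' - m) = 0)
    (hattained : (∃ m ∈ ℳ a, m ≠ 0 ∧ ∃ N : ℕ, x i₀ ^ N • m = 0) ∨
      ∃ t : ℕ, ∃ m ∈ ℳ (a - 1 + t), ∀ m' ∈ ℳ (a - 1), ∀ N : ℕ,
        x i₀ ^ N • (x i₀ ^ t • m' - m) ≠ 0) :
    reg 𝒜 x ℳ = ((a : WithTop ℤ) : WithBot (WithTop ℤ)) := by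
  have h1 : (1 : R) ∈ 𝒜 0 := by simpa using hx 0 0
  have hone : ∀ t, (1 : R) ∈ 𝒜 t → t = 0 := fun t ht => ((hx 0 t).1 (by simpa using ht)).symm
  apply le_antisymm
  · refine iSup_le fun p => ?_
    have hle : aInvariant 𝒜 x ℳ p ≤ (((a - p : ℤ) : WithTop ℤ) : WithBot (WithTop ℤ)) := by
      refine sSup_le ?_
      rintro _ ⟨j, hj, rfl⟩
      replace hj : Nontrivial (LocalCohomology 𝒜 x ℳ p j) := hj
      suffices j ≤ a - p from WithBot.coe_le_coe.2 (WithTop.coe_le_coe.2 this)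
      match p with
      | 0 =>
        obtain ⟨m, hm, hm0, hN⟩ := (nontrivial_localCohomology_zero_iff h1 hone hv).1 hj
        simpa using htors j m hm hm0 hN
      | 1 =>
        by_contra hlt
        obtain ⟨t, m, hm, hm'⟩ := (nontrivial_localCohomology_one_iff hx hv).1 hj
        obtain ⟨m', hmj, N, hN⟩ := hcoker j (by push_cast at hlt; omega) t m hm
        exact hm' m' hmj N hN
      | p + 2 => exact absurd hj (not_nontrivial_localCohomology hv (by omega) j)
    calc _ ≤ (((a - p : ℤ) : WithTop ℤ) : WithBot (WithTop ℤ)) +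
          (((p : ℤ) : WithTop ℤ) : WithBot (WithTop ℤ)) := by gcongr
      _ = _ := by
        rw [← WithBot.coe_add, ← WithTop.coe_add, sub_add_cancel]
  · rcases hattained with h | h
    · refine le_trans ?_ (le_iSup _ 0)
      have := le_sSup (Set.mem_image_of_mem (fun j : ℤ => ((j : WithTop ℤ) : WithBot (WithTop ℤ)))
        (show a ∈ {j : ℤ | Nontrivial (LocalCohomology 𝒜 x ℳ 0 j)} from
          (nontrivial_localCohomology_zero_iff h1 hone hv).2 h))
      simpa [aInvariant] using this
    -- `H^1` enters the regularity with a shift by one, so a class in degree `a - 1` is what attains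
    -- `a`.
    · refine le_trans ?_ (le_iSup _ 1)
      have := le_sSup (Set.mem_image_of_mem (fun j : ℤ => ((j : WithTop ℤ) : WithBot (WithTop ℤ)))
        (show a - 1 ∈ {j : ℤ | Nontrivial (LocalCohomology 𝒜 x ℳ 1 j)} from
          (nontrivial_localCohomology_one_iff hx hv).2 h))
      calc ((a : WithTop ℤ) : WithBot (WithTop ℤ)) =
          (((a - 1 : ℤ) : WithTop ℤ) : WithBot (WithTop ℤ)) +
            ((((1 : ℕ) : ℤ) : WithTop ℤ) : WithBot (WithTop ℤ)) := by
            rw [← WithBot.coe_add, ← WithTop.coe_add, Nat.cast_one, sub_add_cancel]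
        _ ≤ _ := by
          gcongr
          exact this

end OneVariable

end CMRegularity

/-! ### Quotients of polynomial rings by monomial ideals -/

namespace MvPolynomial

variable {σ : Type v} (k : Type u) [Field k] (U : UpperSet (σ →₀ ℕ))

/-- The quotient of the polynomial ring by the ideal spanned by the monomials with exponent
in an upper set. -/
abbrev MonomialQuotient : Type (max u v) :=
  MvPolynomial σ k ⧸ restrictSupportIdeal k (U : Set (σ →₀ ℕ)) U.upper

namespace MonomialQuotient

variable {k U}

theorem mem_restrictSupportIdeal {p : MvPolynomial σ k} :
    p ∈ restrictSupportIdeal k (U : Set (σ →₀ ℕ)) U.upper ↔ ∀ α, α ∉ U → p.coeff α = 0 := by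
  change p ∈ restrictSupport k (U : Set (σ →₀ ℕ)) ↔ _
  rw [mem_restrictSupport_iff]
  exact ⟨fun h α hα => by_contra fun hne => hα (h (by simpa using hne)),
    fun h α hα => by_contra fun hne => (by simpa using hα : p.coeff α ≠ 0) (h α hne)⟩

/-- The class of a polynomial. -/
noncomputable abbrev mk : MvPolynomial σ k →ₐ[k] MonomialQuotient k U :=
  Ideal.Quotient.mkₐ k _

theorem mk_surjective : Function.Surjective (mk : _ →ₐ[k] MonomialQuotient k U) :=
  Ideal.Quotient.mk_surjective

open Classical in
/-- The coefficient of a residue class at a monomial; it is zero at the monomials in `U`. -/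
noncomputable def coeff (α : σ →₀ ℕ) : MonomialQuotient k U →+ k :=
  QuotientAddGroup.lift _ (if α ∈ U then 0 else (coeffAddMonoidHom α : MvPolynomial σ k →+ k)) <| by
    intro p hp
    split_ifs with h
    · rfl
    · exact mem_restrictSupportIdeal.1 hp α h

theorem coeff_mk_of_notMem {α : σ →₀ ℕ} (hα : α ∉ U) (p : MvPolynomial σ k) :
    coeff α (mk p : MonomialQuotient k U) = p.coeff α := by
  classical
  change (if α ∈ U then 0 else (coeffAddMonoidHom α : MvPolynomial σ k →+ k)) p = _
  rw [if_neg hα]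
  rfl

theorem coeff_of_mem {α : σ →₀ ℕ} (hα : α ∈ U) (f : MonomialQuotient k U) : coeff α f = 0 := by
  obtain ⟨p, rfl⟩ := mk_surjective f
  classical
  change (if α ∈ U then 0 else (coeffAddMonoidHom α : MvPolynomial σ k →+ k)) p = _
  rw [if_pos hα]
  rfl

theorem notMem_of_coeff_ne_zero {α : σ →₀ ℕ} {f : MonomialQuotient k U} (h : coeff α f ≠ 0) :
    α ∉ U :=
  fun hα => h (coeff_of_mem hα f)

theorem eq_zero_of_coeff {f : MonomialQuotient k U} (h : ∀ α, α ∉ U → coeff α f = 0) : f = 0 := by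
  obtain ⟨p, rfl⟩ := mk_surjective f
  refine Ideal.Quotient.eq_zero_iff_mem.2 (mem_restrictSupportIdeal.2 fun α hα => ?_)
  rw [← coeff_mk_of_notMem hα]
  exact h α hα

theorem eq_of_coeff {f g : MonomialQuotient k U} (h : ∀ α, α ∉ U → coeff α f = coeff α g) :
    f = g :=
  sub_eq_zero.1 (eq_zero_of_coeff fun α hα => by rw [map_sub, h α hα, sub_self])

theorem exists_coeff_ne_zero {f : MonomialQuotient k U} (h : f ≠ 0) : ∃ α, coeff α f ≠ 0 := by
  by_contra! hcon
  exact h (eq_zero_of_coeff fun α _ => hcon α)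

theorem coeff_mk_X_pow_mul (i : σ) (t : ℕ) {α : σ →₀ ℕ} (hα : α ∉ U) (f : MonomialQuotient k U) :
    coeff α (mk (X i) ^ t * f) = if t ≤ α i then coeff (α - Finsupp.single i t) f else 0 := by
  obtain ⟨p, rfl⟩ := mk_surjective f
  rw [← map_pow, ← map_mul, coeff_mk_of_notMem hα, X_pow_eq_monomial, coeff_monomial_mul',
    coeff_mk_of_notMem (fun h => hα (U.upper tsub_le_self h)), one_mul]
  simp only [Finsupp.single_le_iff]

theorem coeff_mk_monomial_self {α : σ →₀ ℕ} (hα : α ∉ U) :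
    coeff α (mk (monomial α 1) : MonomialQuotient k U) = 1 := by
  classical
  rw [coeff_mk_of_notMem hα, coeff_monomial, if_pos rfl]

theorem eq_of_coeff_mk_monomial_ne_zero {α β : σ →₀ ℕ}
    (h : coeff β (mk (monomial α 1) : MonomialQuotient k U) ≠ 0) : β = α := by
  classical
  rw [coeff_mk_of_notMem (notMem_of_coeff_ne_zero h), coeff_monomial] at h
  exact (of_not_not fun hne => h (if_neg hne)).symm

/-- Membership can be tested monomial by monomial; a quotient by `X i ^ e` is obtained by dividing a
representative and dropping the terms that are not divisible, which vanish modulo `U`. -/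
theorem mem_span_mk_X_pow {i : σ} {e : ℕ} {f : MonomialQuotient k U} :
    f ∈ Ideal.span {mk (X i) ^ e} ↔ ∀ α, coeff α f ≠ 0 → e ≤ α i := by
  constructor
  · intro hf α hα
    obtain ⟨g, rfl⟩ := Ideal.mem_span_singleton.1 hf
    rw [coeff_mk_X_pow_mul i e (notMem_of_coeff_ne_zero hα)] at hα
    exact of_not_not fun h => hα (if_neg h)
  · intro h
    obtain ⟨p, rfl⟩ := mk_surjective f
    refine Ideal.mem_span_singleton.2 ⟨mk (divMonomial p (Finsupp.single i e)), ?_⟩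
    refine eq_of_coeff fun α hα => ?_
    rw [coeff_mk_X_pow_mul i e hα]
    split_ifs with hle
    · rw [coeff_mk_of_notMem (fun h => hα (U.upper tsub_le_self h)), coeff_divMonomial,
        add_tsub_cancel_of_le (Finsupp.single_le_iff.2 hle), coeff_mk_of_notMem hα]
    · exact of_not_not fun h0 => hle (h α h0)

variable (k U) in
/-- The forms of degree `j`. -/
noncomputable def degreeSubmodule (j : ℕ) : Submodule k (MonomialQuotient k U) :=
  (homogeneousSubmodule σ k j).map (mk (U := U)).toLinearMap

theorem mem_degreeSubmodule {j : ℕ} {f : MonomialQuotient k U} :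
    f ∈ degreeSubmodule k U j ↔ ∀ α, coeff α f ≠ 0 → α.degree = j := by
  constructor
  · rintro ⟨p, hp, rfl⟩ α hα
    change coeff α (mk p) ≠ 0 at hα
    rw [coeff_mk_of_notMem (notMem_of_coeff_ne_zero hα)] at hα
    by_contra hne
    exact hα (IsHomogeneous.coeff_eq_zero hp hne)
  · intro h
    obtain ⟨p, rfl⟩ := mk_surjective f
    refine ⟨homogeneousComponent j p, homogeneousComponent_isHomogeneous j p, ?_⟩
    refine eq_of_coeff fun α hα => ?_
    change coeff α (mk (homogeneousComponent j p)) = _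
    rw [coeff_mk_of_notMem hα, coeff_homogeneousComponent]
    split_ifs with hj
    · rw [coeff_mk_of_notMem hα]
    · exact (of_not_not fun h0 => hj (h α h0)).symm

instance : SetLike.GradedMonoid (degreeSubmodule k U) where
  one_mem := ⟨1, isHomogeneous_one σ k, map_one mk⟩
  mul_mem := by
    rintro i j _ _ ⟨p, hp, rfl⟩ ⟨q, hq, rfl⟩
    exact ⟨p * q, hp.mul hq, map_mul mk p q⟩

theorem coeff_coeAddMonoidHom (α : σ →₀ ℕ) (v : DirectSum ℕ fun j => degreeSubmodule k U j) :
    coeff α (DirectSum.coeAddMonoidHom (degreeSubmodule k U) v) =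
      coeff α (v α.degree : MonomialQuotient k U) := by
  classical
  induction v using DirectSum.induction_on with
  | zero => simp
  | of j y =>
    rw [DirectSum.coeAddMonoidHom_of]
    by_cases hj : α.degree = j
    · subst hj
      rw [DirectSum.of_eq_same]
    · rw [DirectSum.of_eq_of_ne _ _ _ hj]
      simpa using of_not_not fun h0 => hj (mem_degreeSubmodule.1 y.2 α h0)
  | add v w hv hw => simp [hv, hw]

theorem isInternal_degreeSubmodule : DirectSum.IsInternal (degreeSubmodule k U) := by
  constructor
  · rw [injective_iff_map_eq_zero]
    intro v hv
    ext j
    refine eq_zero_of_coeff fun α _ => ?_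
    by_cases hj : α.degree = j
    · rw [← hj, ← coeff_coeAddMonoidHom, hv, map_zero]
    · exact of_not_not fun h0 => hj (mem_degreeSubmodule.1 (v j).2 α h0)
  · intro f
    obtain ⟨p, rfl⟩ := mk_surjective f
    change _ ∈ AddMonoidHom.mrange (DirectSum.coeAddMonoidHom (degreeSubmodule k U))
    rw [← sum_homogeneousComponent p, map_sum]
    refine sum_mem fun j _ => ?_
    exact ⟨DirectSum.of (fun j => degreeSubmodule k U j) j
      ⟨_, _, homogeneousComponent_isHomogeneous j p, rfl⟩, DirectSum.coeAddMonoidHom_of _ _ _⟩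

noncomputable instance : GradedAlgebra (degreeSubmodule k U) where
  toDecomposition := isInternal_degreeSubmodule.chooseDecomposition

theorem mk_X_pow_mem_degreeSubmodule (i : σ) (a : ℕ) :
    mk (X i) ^ a ∈ degreeSubmodule k U a :=
  ⟨X i ^ a, isHomogeneous_X_pow i a, map_pow mk _ _⟩

theorem mk_X_pow_mem_degreeSubmodule_iff {i : σ} {a t : ℕ} (h : Finsupp.single i a ∉ U) :
    mk (X i) ^ a ∈ degreeSubmodule k U t ↔ a = t := by
  constructor
  · intro hmem
    have h1 : coeff (Finsupp.single i a) (mk (X i) ^ a : MonomialQuotient k U) = 1 := by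
      rw [← map_pow, X_pow_eq_monomial, coeff_mk_monomial_self h]
    rw [← mem_degreeSubmodule.1 hmem _ (by rw [h1]; exact one_ne_zero), Finsupp.degree_single]
  · rintro rfl
    exact mk_X_pow_mem_degreeSubmodule i a

theorem isStandardGraded {k : Type u} [Field k] {r : ℕ} (U : UpperSet (Fin r →₀ ℕ)) :
    CMRegularity.IsStandardGraded (degreeSubmodule k U) fun i => mk (X i) where
  mem_one i := by simpa using mk_X_pow_mem_degreeSubmodule (k := k) (U := U) i 1
  adjoin_eq_top := by
    have h := AlgHom.map_adjoin (mk : _ →ₐ[k] MonomialQuotient k U) (Set.range X)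
    rw [adjoin_range_X, Algebra.map_top, (AlgHom.range_eq_top _).2 mk_surjective,
      ← Set.range_comp] at h
    exact h.symm

end MonomialQuotient

end MvPolynomial

/-! ### The dimension of `R/I` -/

theorem ringKrullDim_quotient_nilradical (R : Type*) [CommRing R] :
    ringKrullDim (R ⧸ nilradical R) = ringKrullDim R := by
  rw [ringKrullDim_quotient, show PrimeSpectrum.zeroLocus (nilradical R : Set R) = Set.univ from
    Set.eq_univ_of_forall fun p => nilradical_le_prime p.asIdeal]
  exact Order.krullDim_eq_of_orderIso OrderIso.Set.univ

namespace MvPolynomial.MonomialQuotient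

variable {k : Type u} [Field k] {s : ℕ} {U : UpperSet (Fin (s + 2) →₀ ℕ)}

/-- The homomorphism to the polynomial ring in the last `s` variables. -/
noncomputable def dropVars (k : Type u) [Field k] (s : ℕ) :
    MvPolynomial (Fin (s + 2)) k →ₐ[k] MvPolynomial (Fin s) k :=
  aeval (Fin.cons 0 (Fin.cons 0 X))

theorem dropVars_surjective : Function.Surjective (dropVars k s) := by
  rw [← AlgHom.range_eq_top, ← top_le_iff, ← adjoin_range_X, Algebra.adjoin_le_iff]
  rintro _ ⟨i, rfl⟩
  exact ⟨X i.succ.succ, by simp [dropVars]⟩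

theorem dropVars_eq_zero (hU : ∀ α ∈ U, α 0 ≠ 0 ∨ α 1 ≠ 0) {p : MvPolynomial (Fin (s + 2)) k}
    (hp : p ∈ restrictSupportIdeal k (U : Set (Fin (s + 2) →₀ ℕ)) U.upper) :
    dropVars k s p = 0 := by
  rw [dropVars, aeval_def, eval₂_eq]
  refine Finset.sum_eq_zero fun α hα => ?_
  have hαU : α ∈ U := by
    by_contra h
    exact mem_support_iff.1 hα (mem_restrictSupportIdeal.1 hp α h)
  rw [mul_eq_zero]
  right
  rcases hU α hαU with h | h
  · exact Finset.prod_eq_zero (Finsupp.mem_support_iff.2 h) (by simp [h])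
  · refine Finset.prod_eq_zero (Finsupp.mem_support_iff.2 h) ?_
    rw [show (1 : Fin (s + 2)) = Fin.succ 0 from rfl, Fin.cons_succ, Fin.cons_zero]
    exact zero_pow h

theorem ringKrullDim_mvPolynomial_fin (k : Type u) [Field k] (s : ℕ) :
    ringKrullDim (MvPolynomial (Fin s) k) = s := by
  rw [MvPolynomial.ringKrullDim_of_isNoetherianRing, ringKrullDim_eq_zero_of_field]
  simp

/-- Passing to the reduced ring kills the first two variables and does not change the dimension;
what remains is a quotient of the polynomial ring in the last `s` variables. -/
theorem ringKrullDim_le_of_isNilpotent {B : Type u} [CommRing B] [Algebra k B]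
    (π : MvPolynomial (Fin (s + 2)) k →ₐ[k] B) (hπ : Function.Surjective π)
    (h0 : IsNilpotent (π (X 0))) (h1 : IsNilpotent (π (X 1))) : ringKrullDim B ≤ s := by
  let ρ : MvPolynomial (Fin (s + 2)) k →ₐ[k] B ⧸ nilradical B :=
    (Ideal.Quotient.mkₐ k (nilradical B)).comp π
  have hρ : Function.Surjective ρ := Ideal.Quotient.mk_surjective.comp hπ
  let g : MvPolynomial (Fin s) k →ₐ[k] B ⧸ nilradical B := aeval fun i => ρ (X i.succ.succ)
  have h0 : ρ (X 0) = 0 := Ideal.Quotient.eq_zero_iff_mem.2 h0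
  have h1 : ρ (X 1) = 0 := Ideal.Quotient.eq_zero_iff_mem.2 h1
  have hg : g.comp (dropVars k s) = ρ := by
    refine algHom_ext fun i => ?_
    refine Fin.cases ?_ (fun i => Fin.cases ?_ (fun i => ?_) i) i
    · simp [dropVars, h0]
    · simpa [dropVars] using h1.symm
    · simp [dropVars, g]
  rw [← ringKrullDim_quotient_nilradical B, ← ringKrullDim_mvPolynomial_fin k s]
  refine ringKrullDim_le_of_surjective g.toRingHom fun b => ?_
  obtain ⟨p, rfl⟩ := hρ b
  exact ⟨dropVars k s p, congrArg (fun h => h p) hg⟩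

/-- The upper bound comes from nilpotency of the first two variables modulo `I`, the lower bound
from the surjection that `θ` induces onto a polynomial ring in `s` variables. -/
theorem ringKrullDim_quotient_eq {A : Type u} [CommRing A] [Algebra k A]
    (φ : MvPolynomial (Fin (s + 2)) k →ₐ[k] A) (hφ : Function.Surjective φ) {I : Ideal A}
    {d L : ℕ} (h0 : φ (X 0) ^ d ∈ I) (h1 : φ (X 1) ^ L = 0)
    (θ : A →+* MvPolynomial (Fin s) k) (hθ : Function.Surjective θ) (hI : ∀ a ∈ I, θ a = 0) :
    ringKrullDim (A ⧸ I) = s := by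
  apply le_antisymm
  · refine ringKrullDim_le_of_isNilpotent ((Ideal.Quotient.mkₐ k I).comp φ)
      (Ideal.Quotient.mk_surjective.comp hφ) ⟨d, ?_⟩ ⟨L, ?_⟩
    · rw [← map_pow]
      exact Ideal.Quotient.eq_zero_iff_mem.2 (by simpa using h0)
    · rw [AlgHom.comp_apply, ← map_pow, h1, map_zero]
  · rw [← ringKrullDim_mvPolynomial_fin k s]
    exact ringKrullDim_le_of_surjective (Ideal.Quotient.lift I θ hI)
      (Ideal.Quotient.lift_surjective_of_surjective I hI hθ)

/-- If all polynomials in the last `s` variables are reduced modulo the monomials in `U`, and a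
power of the second variable is zero, then killing the first variable up to nilpotents leaves a
ring of dimension `s`. -/
theorem ringKrullDim_quotient_span_mk_X_pow (hU : ∀ α ∈ U, α 0 ≠ 0 ∨ α 1 ≠ 0) {L : ℕ}
    (hL : Finsupp.single 1 L ∈ U) {d : ℕ} (hd : d ≠ 0) :
    ringKrullDim (MonomialQuotient k U ⧸
      Ideal.span {(mk (X 0) ^ d : MonomialQuotient k U)}) = s := by
  refine ringKrullDim_quotient_eq mk mk_surjective (d := d) (L := L)
    (Ideal.mem_span_singleton_self _) ?_
    (Ideal.Quotient.lift _ (dropVars k s).toRingHom fun p hp => dropVars_eq_zero hU hp) ?_ ?_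
  · rw [← map_pow, X_pow_eq_monomial]
    refine eq_zero_of_coeff fun α hα => ?_
    by_contra h
    exact hα (eq_of_coeff_mk_monomial_ne_zero h ▸ hL)
  · exact Ideal.Quotient.lift_surjective_of_surjective _ _ dropVars_surjective
  · intro a ha
    obtain ⟨b, rfl⟩ := Ideal.mem_span_singleton.1 ha
    have h0 : Ideal.Quotient.lift _ (dropVars k s).toRingHom
        (fun p hp => dropVars_eq_zero hU hp) (mk (X 0) : MonomialQuotient k U) = 0 := by
      change dropVars k s (X 0) = 0
      simp [dropVars]
    rw [map_mul, map_pow, h0, zero_pow hd, zero_mul]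

end MvPolynomial.MonomialQuotient

/-! ### The algebra realizing a given regularity function -/

namespace CMRegularity

open MvPolynomial MvPolynomial.MonomialQuotient

/-- The exponents `(a, b)` of the monomials `x ^ a * w ^ b` that are not killed in the algebra
realizing the regularity function `f`. -/
def StandardPair (d : ℕ) (f : ℕ → ℕ) (m a b : ℕ) : Prop :=
  b + d * m ≤ f m ∨ ∃ n, 1 ≤ n ∧ n < m ∧ b + d * (n + 1) ≤ f n + 1 ∧ a < d * (n + 1)

theorem StandardPair.mono {d : ℕ} {f : ℕ → ℕ} {m a b a' b' : ℕ} (h : StandardPair d f m a b)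
    (ha : a' ≤ a) (hb : b' ≤ b) : StandardPair d f m a' b' := by
  rcases h with h | ⟨n, h1, h2, h3, h4⟩
  · exact Or.inl (by omega)
  · exact Or.inr ⟨n, h1, h2, by omega, by omega⟩

/-- The exponents of the monomials in `x, w, z_1, …, z_s` that are killed: `x z_i`, `w z_i`, and
the monomials in `x, w` that are not standard. -/
def killedExponents (d : ℕ) (f : ℕ → ℕ) (m s : ℕ) : UpperSet (Fin (s + 2) →₀ ℕ) where
  carrier := {α | (α 0 ≠ 0 ∨ α 1 ≠ 0) ∧
    ((∃ i, i ≠ 0 ∧ i ≠ 1 ∧ α i ≠ 0) ∨ ¬ StandardPair d f m (α 0) (α 1))}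
  upper' := by
    rintro α β hle ⟨h1, h2⟩
    have h0 (i) (h : α i ≠ 0) : β i ≠ 0 := by have := hle i; omega
    exact ⟨h1.imp (h0 0) (h0 1), h2.imp (fun ⟨i, hi, hi', h⟩ => ⟨i, hi, hi', h0 i h⟩)
      fun h h' => h (h'.mono (hle 0) (hle 1))⟩

section Exponents

variable {d : ℕ} {f : ℕ → ℕ} {m s : ℕ}

theorem standardPair_of_notMem {α : Fin (s + 2) →₀ ℕ} (h : α ∉ killedExponents d f m s)
    (h0 : α 0 ≠ 0) : StandardPair d f m (α 0) (α 1) := by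
  by_contra hp
  exact h ⟨Or.inl h0, Or.inr hp⟩

theorem degree_of_notMem {α : Fin (s + 2) →₀ ℕ} (h : α ∉ killedExponents d f m s)
    (h0 : α 0 ≠ 0) : α.degree = α 0 + α 1 := by
  have hz : ∀ i : Fin s, α i.succ.succ = 0 := by
    intro i
    by_contra hne
    exact h ⟨Or.inl h0, Or.inl ⟨_, Fin.succ_ne_zero _, fun h => Fin.succ_ne_zero i
      (Fin.succ_injective _ h), hne⟩⟩
  rw [Finsupp.degree_eq_sum, Fin.sum_univ_succ, Fin.sum_univ_succ]
  simp [hz]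

theorem add_single_notMem {α : Fin (s + 2) →₀ ℕ} (h : α ∉ killedExponents d f m s)
    (h0 : α 0 ≠ 0) {N : ℕ} (hN : StandardPair d f m (α 0 + N) (α 1)) :
    α + Finsupp.single 0 N ∉ killedExponents d f m s := by
  rintro ⟨-, ⟨i, hi, hi', hne⟩ | hp⟩
  · exact h ⟨Or.inl h0, Or.inl ⟨i, hi, hi', by simpa [Finsupp.single_eq_of_ne hi] using hne⟩⟩
  · exact hp (by simpa using hN)

/-- The exponent of `x ^ a * w ^ b`. -/
noncomputable def pairExponent (s a b : ℕ) : Fin (s + 2) →₀ ℕ :=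
  Finsupp.single 0 a + Finsupp.single 1 b

@[simp] theorem pairExponent_zero (a b : ℕ) : pairExponent s a b 0 = a := by
  simp [pairExponent]

@[simp] theorem pairExponent_one (a b : ℕ) : pairExponent s a b 1 = b := by
  simp [pairExponent]

@[simp] theorem degree_pairExponent (a b : ℕ) : (pairExponent s a b).degree = a + b := by
  simp [pairExponent]

theorem pairExponent_notMem {a b : ℕ} (h : StandardPair d f m a b) :
    pairExponent s a b ∉ killedExponents d f m s := by
  rintro ⟨-, ⟨i, hi, hi', hne⟩ | hp⟩
  · simp [pairExponent, Finsupp.single_eq_of_ne hi, Finsupp.single_eq_of_ne hi'] at hne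
  · exact hp (by simpa using h)

theorem pairExponent_sub_single (a b t : ℕ) :
    pairExponent s a b - Finsupp.single 0 t = pairExponent s (a - t) b := by
  ext i
  by_cases hi : i = 0
  · subst hi; simp
  · simp [pairExponent, Finsupp.single_eq_of_ne hi]

end Exponents

section Realization

variable {k : Type u} [Field k] {d : ℕ} {f : ℕ → ℕ} {m s : ℕ}

/-- Multiples of `x` are killed by a power of each of the other variables. -/
theorem mk_X_pow_mul_eq_zero {U : UpperSet (Fin (s + 2) →₀ ℕ)} {i : Fin (s + 2)} {N : ℕ}
    (hi : i ≠ 0) (hU : ∀ α : Fin (s + 2) →₀ ℕ, α 0 ≠ 0 → N ≤ α i → α ∈ U) {e : ℕ} (he : 1 ≤ e)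
    {g : MonomialQuotient k U} (hg : g ∈ Ideal.span {(mk (X 0) ^ e : MonomialQuotient k U)}) :
    mk (X i) ^ N * g = 0 := by
  refine eq_zero_of_coeff fun α hα => ?_
  rw [coeff_mk_X_pow_mul i N hα]
  split_ifs with hle
  · by_contra hne
    have h0 := mem_span_mk_X_pow.1 hg _ hne
    rw [Finsupp.tsub_apply, Finsupp.single_eq_of_ne hi.symm] at h0
    exact hα (hU α (by omega) hle)
  · rfl

/-- In a standard pair `b ≤ f n + 1 ≤ f 1 + 1`, so `w ^ (f 1 + 2)` kills all multiples of `x`; for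
the `z_i` the first power already does. -/
theorem mem_killedExponents_of_le (hm : 1 ≤ m) (hanti : ∀ a b, 1 ≤ a → a ≤ b → b ≤ m → f b ≤ f a)
    {i : Fin (s + 2)} (hi : i ≠ 0) {α : Fin (s + 2) →₀ ℕ} (h0 : α 0 ≠ 0) (hα : f 1 + 2 ≤ α i) :
    α ∈ killedExponents d f m s := by
  refine ⟨Or.inl h0, ?_⟩
  by_cases h1 : i = 1
  · subst h1
    right
    rintro (h | ⟨n, hn, hnm, h, -⟩)
    · have := hanti 1 m le_rfl hm le_rfl
      omega
    · have := hanti 1 n le_rfl hn hnm.le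
      omega
  · exact Or.inl ⟨i, hi, h1, by omega⟩

theorem mem_idealDegree {U : UpperSet (Fin (s + 2) →₀ ℕ)} {J : Ideal (MonomialQuotient k U)}
    {j : ℕ} {y : J} : y ∈ idealDegree (degreeSubmodule k U) J j ↔
      (y : MonomialQuotient k U) ∈ degreeSubmodule k U j := by
  constructor
  · rintro (rfl | h)
    · exact zero_mem _
    · exact h.2
  · exact fun h => Or.inr ⟨Int.natCast_nonneg j, h⟩

/-- A monomial of a torsion element cannot lie in an infinite row, where multiplication by `x` is
injective. So it lies under a corner `n'`. Divisibility by `x ^ (d * n)` forces `n ≤ n'`, and the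
degree is at most `(d * (n' + 1) - 1) + (f n' + 1 - d * (n' + 1)) = f n' ≤ f n`. -/
theorem le_of_mem_torsion (hanti : ∀ a b, 1 ≤ a → a ≤ b → b ≤ m → f b ≤ f a) {e n : ℕ}
    (hn : 1 ≤ n) (he : 1 ≤ e) (hne : d * n ≤ e)
    {g : MonomialQuotient k (killedExponents d f m s)}
    (hg : g ∈ Ideal.span {(mk (X 0) ^ e : MonomialQuotient k (killedExponents d f m s))})
    {j N : ℕ} (hj : g ∈ degreeSubmodule k (killedExponents d f m s) j) (h0 : g ≠ 0)
    (hN : mk (X 0) ^ N * g = 0) : j ≤ f n := by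
  obtain ⟨α, hα⟩ := exists_coeff_ne_zero h0
  have hU := notMem_of_coeff_ne_zero hα
  have hα0 := mem_span_mk_X_pow.1 hg α hα
  have hdeg := mem_degreeSubmodule.1 hj α hα
  rw [degree_of_notMem hU (by omega)] at hdeg
  rcases standardPair_of_notMem hU (by omega) with h | ⟨n', -, hn'm, hb, ha⟩
  · have hU' := add_single_notMem hU (by omega) (N := N) (Or.inl h)
    have := coeff_mk_X_pow_mul 0 N hU' g
    rw [hN, map_zero, if_pos (by simp), add_tsub_cancel_right] at this
    exact absurd this.symm hα
  · have hlt : n < n' + 1 := Nat.lt_of_mul_lt_mul_left (lt_of_le_of_lt (hne.trans hα0) ha)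
    have := hanti n n' hn (by omega) hn'm.le
    omega

/-- Up to torsion only the rows `w ^ b` with `b ≤ c` matter. There a monomial of degree at least `e
+ c + t` has `x`-exponent at least `e + t`, so it can be divided by `x ^ t` without leaving `(x ^
e)`. -/
theorem exists_torsion_eq_zero {e : ℕ} (he : 1 ≤ e) {c j t : ℕ} (hc : f m ≤ c + d * m)
    (hj : e + c ≤ j) {g : MonomialQuotient k (killedExponents d f m s)}
    (hg : g ∈ Ideal.span {(mk (X 0) ^ e : MonomialQuotient k (killedExponents d f m s))})
    (hgj : g ∈ degreeSubmodule k (killedExponents d f m s) (j + t)) :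
    ∃ g' ∈ Ideal.span {(mk (X 0) ^ e : MonomialQuotient k (killedExponents d f m s))},
      g' ∈ degreeSubmodule k (killedExponents d f m s) j ∧
        ∃ N : ℕ, mk (X 0) ^ N * (mk (X 0) ^ t * g' - g) = 0 := by
  obtain ⟨p, hp, rfl⟩ := hgj
  change mk p ∈ _ at hg
  change ∃ g' ∈ _, g' ∈ _ ∧ ∃ N : ℕ, mk (X 0) ^ N * (mk (X 0) ^ t * g' - mk p) = 0
  -- This is `p / x ^ t` restricted to the terms divisible by `x ^ (e + t)`.
  set g' : MonomialQuotient k (killedExponents d f m s) :=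
    mk (X 0) ^ e * mk (divMonomial p (Finsupp.single 0 (e + t))) with hg'
  have hcoeff : ∀ α, α ∉ killedExponents d f m s → coeff α g' =
      if e ≤ α 0 then p.coeff (α + Finsupp.single 0 t) else 0 := by
    intro α hα
    rw [hg', coeff_mk_X_pow_mul 0 e hα]
    split_ifs with hle
    · rw [coeff_mk_of_notMem (fun h => hα (UpperSet.upper _ tsub_le_self h)), coeff_divMonomial,
        Finsupp.single_add, add_right_comm, add_tsub_cancel_of_le (Finsupp.single_le_iff.2 hle)]
    · rfl
  have hdegp : ∀ α, p.coeff α ≠ 0 → α.degree = j + t := fun α hα => by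
    by_contra hne
    exact hα (IsHomogeneous.coeff_eq_zero hp hne)
  -- Multiplication by `x ^ (d * m)` annihilates all finite rows; the extra factor `x` makes the
  -- `x`-exponent nonzero even when `d * m = 0`.
  refine ⟨g', Ideal.mul_mem_right _ _ (Ideal.mem_span_singleton_self _), ?_, d * m + 1, ?_⟩
  · refine mem_degreeSubmodule.2 fun α hα => ?_
    rw [hcoeff α (notMem_of_coeff_ne_zero hα)] at hα
    split_ifs at hα
    · have := hdegp _ hα
      rw [map_add, Finsupp.degree_single] at this
      omega
    · exact absurd rfl hα
  · refine eq_zero_of_coeff fun α hα => ?_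
    rw [coeff_mk_X_pow_mul 0 _ hα]
    split_ifs with hle
    swap
    · rfl
    have hstd : α 1 + d * m ≤ f m := by
      rcases standardPair_of_notMem hα (by omega) with h | ⟨n', -, hn'm, -, ha⟩
      · exact h
      · have := Nat.mul_le_mul_left d (show n' + 1 ≤ m from hn'm)
        omega
    have hγ : α - Finsupp.single 0 (d * m + 1) ∉ killedExponents d f m s :=
      fun h => hα (UpperSet.upper _ tsub_le_self h)
    have hγ1 : (α - Finsupp.single 0 (d * m + 1) : Fin (s + 2) →₀ ℕ) 1 = α 1 := by simp
    set γ := α - Finsupp.single 0 (d * m + 1)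
    have hγt : γ - Finsupp.single 0 t ∉ killedExponents d f m s :=
      fun h => hγ (UpperSet.upper _ tsub_le_self h)
    -- The discarded terms do not matter: one with `γ 0 ≠ 0` would have degree `γ 0 + γ 1 < e + t +
    -- c ≤ j + t`, and `γ 0 = 0` is excluded by `1 ≤ e`.
    have hsmall : γ 0 < e + t → p.coeff γ = 0 := by
      intro hlt
      by_contra hne
      by_cases h0 : γ 0 = 0
      · have := mem_span_mk_X_pow.1 hg γ (by rwa [coeff_mk_of_notMem hγ])
        omega
      · have := hdegp γ hne
        rw [degree_of_notMem hγ h0] at this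
        omega
    rw [map_sub, coeff_mk_X_pow_mul 0 t hγ, coeff_mk_of_notMem hγ, sub_eq_zero]
    split_ifs with ht
    · rw [hcoeff _ hγt, tsub_add_cancel_of_le (Finsupp.single_le_iff.2 ht)]
      split_ifs with h
      · rfl
      · refine (hsmall ?_).symm
        simp only [Finsupp.tsub_apply, Finsupp.single_eq_same] at h
        omega
    · exact (hsmall (by omega)).symm

/-- A function that weakly decreases until it becomes linear of slope `d` is the function
`reg I ^ n` of a principal ideal generated by a form of degree `d`. -/
theorem isRegFunction_of_antitone_of_linear (k : Type u) [Field k] {d : ℕ} (hd : 1 ≤ d) (s : ℕ)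
    {f : ℕ → ℕ} {m : ℕ} (hm : 1 ≤ m) (hf : d * m ≤ f m)
    (hdec : ∀ n, 1 ≤ n → n < m → f (n + 1) ≤ f n) (hlin : ∀ n, m ≤ n → f (n + 1) = f n + d) :
    IsRegFunction k d s fun n => (f n : ℤ) := by
  have hanti : ∀ a b, 1 ≤ a → a ≤ b → b ≤ m → f b ≤ f a := by
    intro a b ha hab hb
    induction b, hab using Nat.le_induction with
    | base => exact le_rfl
    | succ b hab ih => exact (hdec b (by omega) (by omega)).trans (ih (by omega))
  have hlin' : ∀ n, m ≤ n → f n + d * m = f m + d * n := by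
    intro n hn
    induction n, hn using Nat.le_induction with
    | base => rfl
    | succ n hn ih => rw [hlin n hn, Nat.mul_succ]; omega
  obtain ⟨c, hc⟩ := Nat.exists_eq_add_of_le' hf
  -- The contribution of the infinite rows never exceeds `f n`.
  have hlow : ∀ n, 1 ≤ n → d * n + c ≤ f n := by
    intro n hn
    rcases le_total m n with h | h
    · have := hlin' n h
      omega
    · have := hanti n m hn h le_rfl
      have := Nat.mul_le_mul_left d h
      omega
  set U := killedExponents d f m s with hUdef
  have hx0 : ∀ a, pairExponent s a 0 ∉ U := fun a => pairExponent_notMem (Or.inl (by omega))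
  have hsingle : ∀ a, Finsupp.single 0 a = pairExponent s a 0 := fun a => by simp [pairExponent]
  have hxne : ∀ a, (mk (X 0) ^ a : MonomialQuotient k U) ≠ 0 := by
    intro a h0
    have := coeff_mk_monomial_self (k := k) (hx0 a)
    rw [← hsingle, ← X_pow_eq_monomial, map_pow, h0, map_zero] at this
    exact zero_ne_one this
  have hxdeg : ∀ a t, mk (X 0) ^ a ∈ degreeSubmodule k U t ↔ a = t := fun a t =>
    mk_X_pow_mem_degreeSubmodule_iff (by rw [hsingle]; exact hx0 a)
  have hpow : ∀ n, Ideal.span {(mk (X 0) ^ d : MonomialQuotient k U)} ^ n =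
      Ideal.span {mk (X 0) ^ (d * n)} := fun n => by
    rw [Ideal.span_singleton_pow, ← pow_mul]
  refine ⟨MonomialQuotient k U, inferInstance, inferInstance, degreeSubmodule k U, inferInstance,
    s + 2, fun i => mk (X i), Ideal.span {mk (X 0) ^ d}, isStandardGraded U,
    ⟨{mk (X 0) ^ d}, ?_, rfl⟩, ?_, ?_, ?_, ?_⟩
  · exact Set.singleton_subset_iff.2 (mk_X_pow_mem_degreeSubmodule 0 d)
  · intro htop
    have h1 := (Ideal.eq_top_iff_one _).1 htop
    have h0 : (0 : Fin (s + 2) →₀ ℕ) ∉ U := by simpa [pairExponent] using hx0 0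
    have hc1 : coeff 0 (1 : MonomialQuotient k U) = 1 := by
      rw [← map_one mk, coeff_mk_of_notMem h0, coeff_zero_one]
    have := mem_span_mk_X_pow.1 h1 0 (by rw [hc1]; exact one_ne_zero)
    simp only [Finsupp.coe_zero, Pi.zero_apply] at this
    omega
  · intro n _ hbot
    rw [hpow, Ideal.span_singleton_eq_bot] at hbot
    exact hxne _ hbot
  · refine ringKrullDim_quotient_span_mk_X_pow (U := U) (fun α hα => hα.1) (L := f 1 + 2) ?_ (by omega)
    refine ⟨Or.inr (by simp), Or.inr ?_⟩
    rw [Finsupp.single_eq_same]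
    rintro (h | ⟨n, hn, hnm, h, -⟩)
    · have := hanti 1 m le_rfl hm le_rfl
      omega
    · have := hanti 1 n le_rfl hn hnm.le
      omega
  · intro n hn
    rw [hpow]
    beta_reduce
    have he : 1 ≤ d * n := Nat.mul_pos hd hn
    refine reg_eq_of_forall_subsingleton (i₀ := 0) hxdeg ?_ ?_ ?_ ?_
    · intro F i hiF hi
      refine subsingleton_localizedModule hiF (N := f 1 + 2) fun y => Subtype.ext ?_
      exact mk_X_pow_mul_eq_zero hi (fun α h0 h => mem_killedExponents_of_le hm hanti hi h0 h)
        he y.2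
    · rintro j y hy hy0 ⟨N, hN⟩
      rcases hy with rfl | ⟨hj, hy⟩
      · exact absurd rfl hy0
      · have := le_of_mem_torsion hanti hn he le_rfl y.2 hy (fun h => hy0 (Subtype.ext h))
          (congrArg Subtype.val hN)
        omega
    · intro j hj t y hy
      lift j to ℕ using (by omega)
      rw [← Nat.cast_add, mem_idealDegree] at hy
      have := hlow n hn
      obtain ⟨g', hg', hgj, N, hN⟩ := exists_torsion_eq_zero he (c := c) (by omega) (by omega)
        y.2 hy
      exact ⟨⟨g', hg'⟩, mem_idealDegree.2 hgj, N, Subtype.ext hN⟩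
    · by_cases hnm : n < m
      · left
        have h1 := hanti n m hn hnm.le le_rfl
        have h2 := Nat.mul_le_mul_left d (show n + 1 ≤ m from hnm)
        have h3 : d * (n + 1) = d * n + d := Nat.mul_succ d n
        -- The corner of the staircase, of degree `a + b = f n`. The subtraction in `b` is not
        -- truncated, since `d * (n + 1) ≤ d * m ≤ f m ≤ f n`; the same chain gives `b > c`, so that
        -- `x ^ (d * m)` kills the corner.
        set a := d * (n + 1) - 1 with ha
        set b := f n + 1 - d * (n + 1) with hb
        have hU : pairExponent s a b ∉ U :=
          pairExponent_notMem (Or.inr ⟨n, hn, hnm, by omega, by omega⟩)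
        refine ⟨⟨mk (monomial (pairExponent s a b) 1), ?_⟩, ?_, ?_, d * m, Subtype.ext ?_⟩
        · refine mem_span_mk_X_pow.2 fun α hα => ?_
          rw [eq_of_coeff_mk_monomial_ne_zero hα, pairExponent_zero]
          omega
        · refine mem_idealDegree.2 (mem_degreeSubmodule.2 fun α hα => ?_)
          rw [eq_of_coeff_mk_monomial_ne_zero hα, degree_pairExponent]
          omega
        · intro h
          have h' := coeff_mk_monomial_self (k := k) hU
          rw [show (mk (monomial (pairExponent s a b) 1) : MonomialQuotient k U) = 0 from
            congrArg Subtype.val h, map_zero] at h'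
          exact zero_ne_one h'
        · change mk (X 0) ^ (d * m) * mk (monomial (pairExponent s a b) 1) = 0
          refine eq_zero_of_coeff fun α hα => ?_
          rw [coeff_mk_X_pow_mul 0 _ hα]
          split_ifs with hle
          swap
          · rfl
          by_contra hne
          have heq := eq_of_coeff_mk_monomial_ne_zero hne
          have heq1 := congrArg (fun β => β 1) heq
          simp only [Finsupp.tsub_apply, pairExponent_one] at heq1
          rw [Finsupp.single_eq_of_ne (by simp), tsub_zero] at heq1
          rcases standardPair_of_notMem hα (by omega) with h | ⟨n', -, hn'm, -, ha'⟩
          · omega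
          · have := Nat.mul_le_mul_left d (show n' + 1 ≤ m from hn'm)
            omega
      · right
        push Not at hnm
        have h1 := hlin' n hnm
        have hU : ∀ a, pairExponent s a c ∉ U := fun a => pairExponent_notMem (Or.inl (by omega))
        -- The fraction `x ^ (d * n) * w ^ c / x` has degree `f n - 1`. It does not come from `I ^
        -- n`, whose elements have zero coefficient at `x ^ (d * n - 1) * w ^ c`, and the infinite
        -- row `w ^ c` carries no torsion that could repair this.
        refine ⟨1, ⟨mk (monomial (pairExponent s (d * n) c) 1), ?_⟩, ?_, ?_⟩
        · refine mem_span_mk_X_pow.2 fun α hα => ?_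
          rw [eq_of_coeff_mk_monomial_ne_zero hα, pairExponent_zero]
        · rw [Nat.cast_one, sub_add_cancel]
          refine mem_idealDegree.2 (mem_degreeSubmodule.2 fun α hα => ?_)
          rw [eq_of_coeff_mk_monomial_ne_zero hα, degree_pairExponent]
          omega
        · rintro ⟨g, hg⟩ - N hN
          have hN' : mk (X 0) ^ N * (mk (X 0) ^ 1 * g - mk (monomial (pairExponent s (d * n) c) 1))
              = 0 := congrArg Subtype.val hN
          have h2 := coeff_mk_X_pow_mul 0 N (hU (d * n + N))
            (mk (X 0) ^ 1 * g - mk (monomial (pairExponent s (d * n) c) 1) : MonomialQuotient k U)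
          rw [hN', map_zero, if_pos (by simp), pairExponent_sub_single, Nat.add_sub_cancel, map_sub,
            coeff_mk_X_pow_mul 0 1 (hU _), coeff_mk_monomial_self (hU _), pairExponent_zero,
            if_pos he, pairExponent_sub_single] at h2
          have h3 : coeff (pairExponent s (d * n - 1) c) g = 0 := by
            by_contra hne
            have := mem_span_mk_X_pow.1 hg _ hne
            rw [pairExponent_zero] at this
            omega
          rw [h3, zero_sub] at h2
          exact one_ne_zero (neg_eq_zero.1 h2.symm)

end Realization

end CMRegularity

/-! ### The three statements -/

theorem theorem3p2 {k : Type u} [Field k] (d : ℕ) (hd : 1 ≤ d) :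
    -- weakly decreasing sequences with large jumps before they stabilize are defect sequences
    (∀ (e : ℕ → ℕ) (m : ℕ), AntitoneOn e (Set.Ici 1) →
      IsLeast {m : ℕ | 1 ≤ m ∧ ∀ n, m < n → e n = e m} m →
      (∀ n, 1 ≤ n → n < m → e (n + 1) + d ≤ e n) →
      CMRegularity.IsDefectSequence k d 0 e) ∧
    -- functions that weakly decrease until they become linear of slope `d`
    (∀ (s : ℕ) (f : ℕ → ℕ) (m : ℕ), 1 ≤ m → (∀ n, 1 ≤ n → d * n ≤ f n) →
      (∀ n, 1 ≤ n → n < m → f (n + 1) ≤ f n) →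
      (∀ n, m ≤ n → f (n + 1) = f n + d) →
      CMRegularity.IsRegFunction k d s fun n => (f n : ℤ)) ∧
    -- the differences of a defect sequence need not be weakly decreasing
    (∃ e : ℕ → ℕ, CMRegularity.IsDefectSequence k d 0 e ∧
      ¬ AntitoneOn (fun n => (e n : ℤ) - e (n + 1)) (Set.Ici 1)) := by
  have key : ∀ (e : ℕ → ℕ) (m : ℕ), 1 ≤ m → (∀ n, m < n → e n = e m) →
      (∀ n, 1 ≤ n → n < m → e (n + 1) + d ≤ e n) → CMRegularity.IsDefectSequence k d 0 e := by
    intro e m hm hconst hjump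
    -- Drops of at least `d` in `e` say exactly that `d * n + e n` is weakly decreasing up to `m`.
    have h := CMRegularity.isRegFunction_of_antitone_of_linear k hd 0 (f := fun n => d * n + e n)
      hm (Nat.le_add_right _ _) (fun n hn hnm => ?_) (fun n hn => ?_)
    · simpa [CMRegularity.IsDefectSequence] using h
    · have := hjump n hn hnm
      simp only [Nat.mul_succ]
      omega
    · have h1 := hconst (n + 1) (by omega)
      have h2 : e n = e m := by
        rcases hn.eq_or_lt with rfl | h
        · rfl
        · exact hconst n h
      simp only [Nat.mul_succ]
      omega
  refine ⟨fun e m _ hm hjump => key e m hm.1.1 hm.1.2 hjump, fun s f m hm hf hdec hlin =>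
    CMRegularity.isRegFunction_of_antitone_of_linear k hd s hm (hf m hm) hdec hlin,
    -- The sequence `3d, 2d, 0, 0, …` drops by `d` and then by `2d`, so its differences increase.
    fun n => if n ≤ 1 then 3 * d else if n = 2 then 2 * d else 0, key _ 3 (by norm_num) ?_ ?_, ?_⟩
  · intro n hn
    split_ifs <;> omega
  · intro n hn hn3
    interval_cases n <;> simp <;> omega
  · intro h
    have := h (show (1 : ℕ) ∈ Set.Ici 1 by simp) (show (2 : ℕ) ∈ Set.Ici 1 by simp) (by norm_num)
    norm_num at this
    omega
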